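/- Let $N\in\mathbb N$ and let $\omega:[0,\infty)\to[0,\infty)$ be a non-quasianalytic weight function, i.e. a continuous increasing (non-decreasing) function such that: ($\alpha$) there is $K\ge 1$ with $\omega(2t)\le K(1+\omega(t))$ for all $t\ge 0$; ($\beta$) $\int_1^\infty \frac{\omega(t)}{1+t^2}\,dt<\infty$; ($\gamma$) there are $a\in\mathbb R$, $b>0$ with $\omega(t)\ge a+b\log(1+t)$ for all $t\ge 0$; ($\delta$) $\varphi_\omega(t)=\omega(e^t)$ is convex on $\mathbb R$. Write $\omega(x)=\omega(|x|)$ for $x\in\mathbb R^N$, and $\varphi^*_\omega(s)=\sup_{t\ge 0}\{st-\varphi_\omega(t)\}\in(-\infty,+\infty]$ for $s\ge 0$, with the convention $\exp(-\infty)=0$. All functions are complex-valued. For $m,n\in\mathbb N=\{1,2,\dots\}$ let $\mathcal O^m_{n,\omega}(\mathbb R^N)$ be the space of all $f\in C^\infty(\mathbb R^N)$ with $$r_{m,n}(f):=\sup_{\alpha\in\mathbb N_0^N}\sup_{x\in\mathbb R^N}|\partial^\alpha f(x)|\exp\Big(-n\omega(x)-m\varphi^*_\omega\big(\tfrac{|\alpha|}{m}\big)\Big)<\infty,$$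 normed by $r_{m,n}$. Equip $\bigcup_{n\ge1}\mathcal O^m_{n,\omega}(\mathbb R^N)$ with the inductive limit topology, i.e. the finest locally convex topology for which all inclusions $\mathcal O^m_{n,\omega}(\mathbb R^N)\hookrightarrow\bigcup_{k\ge1}\mathcal O^m_{k,\omega}(\mathbb R^N)$ are continuous. Let $\mathcal O_{M,\omega}(\mathbb R^N)=\bigcap_{m\ge1}\bigcup_{n\ge1}\mathcal O^m_{n,\omega}(\mathbb R^N)$, and let $t$ be the projective topology on it, i.e. the coarsest topology for which all inclusions $\mathcal O_{M,\omega}(\mathbb R^N)\hookrightarrow\bigcup_{n\ge1}\mathcal O^m_{n,\omega}(\mathbb R^N)$, $m\in\mathbb N$, are continuous. Let $\mathcal S_\omega(\mathbb R^N)$ be the set of all $g\in L^1(\mathbb R^N)$ such that $g,\hat g\in C^\infty(\mathbb R^N)$, where $\hat g(\xi)=\int_{\mathbb R^N} g(x)e^{-ix\xi}\,dx$, and $\|\exp(\lambda\omega)\partial^\alpha g\|_\infty<\infty$, $\|\exp(\lambda\omega)\partial^\alpha \hat g\|_\infty<\infty$ for all $\lambda>0$ and $\alpha\in\mathbb N_0^N$.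 Let $\tau$ be the locally convex topology on $\mathcal O_{M,\omega}(\mathbb R^N)$ generated by the seminorms $$q_{m,g}(f):=\sup_{\alpha\in\mathbb N_0^N}\sup_{x\in\mathbb R^N}|g(x)||\partial^\alpha f(x)|\exp\Big(-m\varphi^*_\omega\big(\tfrac{|\alpha|}{m}\big)\Big),\qquad m\in\mathbb N,\ g\in\mathcal S_\omega(\mathbb R^N),$$ which are finite on $\mathcal O_{M,\omega}(\mathbb R^N)$. Then the identity map $(\mathcal O_{M,\omega}(\mathbb R^N),t)\to(\mathcal O_{M,\omega}(\mathbb R^N),\tau)$ is continuous, i.e. $\tau$ is coarser than $t$. Moreover, $(\mathcal O_{M,\omega}(\mathbb R^N),t)$ and $(\mathcal O_{M,\omega}(\mathbb R^N),\tau)$ have the same bounded subsets. -/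

import Mathlib

open scoped Topology

noncomputable section

namespace OMomega

/-- Non-quasianalytic weight functions `ω : [0,∞) → [0,∞)`. Only the values of `toFun` on `[0,∞)`
are constrained, and only those are ever used. -/
structure WeightFunction where
  toFun : ℝ → ℝ
  nonneg : ∀ t, 0 ≤ t → 0 ≤ toFun t
  continuousOn : ContinuousOn toFun (Set.Ici 0)
  monotoneOn : MonotoneOn toFun (Set.Ici 0)
  /-- condition (α) -/
  doubling : ∃ K : ℝ, 1 ≤ K ∧ ∀ t, 0 ≤ t → toFun (2 * t) ≤ K * (1 + toFun t)
  /-- condition (β) -/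
  integrable : MeasureTheory.IntegrableOn (fun t : ℝ => toFun t / (1 + t ^ 2)) (Set.Ioi 1)
  /-- condition (γ) -/
  log_le : ∃ a b : ℝ, 0 < b ∧ ∀ t, 0 ≤ t → a + b * Real.log (1 + t) ≤ toFun t
  /-- condition (δ) -/
  convex : ConvexOn ℝ Set.univ (fun t : ℝ => toFun (Real.exp t))

/-- The Young conjugate `φ*(s) = sup_{t ≥ 0} (s t - φ(t))` of `φ(t) = ω(exp t)`. The supremum is
taken in the extended reals: it can be `+∞`, e.g. when `ω(t) = log (1 + t)` and `s > 1`. -/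
def youngConj (ω : WeightFunction) (s : ℝ) : EReal :=
  ⨆ (t : ℝ) (_ : 0 ≤ t), ((s * t - ω.toFun (Real.exp t) : ℝ) : EReal)

/-- The factor `exp (-m φ*(k/m))`, which is `0` when `φ*(k/m) = +∞`. -/
def expNeg (ω : WeightFunction) (m : ℕ+) (k : ℕ) : ℝ :=
  (EReal.exp (-(((m : ℝ) : EReal) * youngConj ω ((k : ℝ) / (m : ℝ))))).toReal

lemma expNeg_nonneg (ω : WeightFunction) (m : ℕ+) (k : ℕ) : 0 ≤ expNeg ω m k :=
  ENNReal.toReal_nonneg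

/-- `ℝ^N` with its Euclidean norm. -/
abbrev Eucl (N : ℕ) : Type := EuclideanSpace ℝ (Fin N)

/-- The space `C^∞(ℝ^N)` of complex-valued smooth functions. -/
def CInf (N : ℕ) : Submodule ℂ (Eucl N → ℂ) where
  carrier := {f | ContDiff ℝ (⊤ : ℕ∞) f}
  add_mem' {f g} (hf : ContDiff ℝ (⊤ : ℕ∞) f) (hg : ContDiff ℝ (⊤ : ℕ∞) g) := hf.add hg
  zero_mem' := (contDiff_const : ContDiff ℝ (⊤ : ℕ∞) fun _ : Eucl N => (0 : ℂ))
  smul_mem' c f (hf : ContDiff ℝ (⊤ : ℕ∞) f) := hf.const_smul c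

lemma CInf.contDiff {N : ℕ} (f : CInf N) : ContDiff ℝ (⊤ : ℕ∞) f.1 := f.2

/-- The partial derivative `∂_i` on `C^∞(ℝ^N)`. -/
def pderiv {N : ℕ} (i : Fin N) : Module.End ℂ (CInf N) where
  toFun f := ⟨fun x => fderiv ℝ f.1 x (EuclideanSpace.single i 1),
    ((CInf.contDiff f).fderiv_right (m := (⊤ : ℕ∞)) (by simp)).clm_apply contDiff_const⟩
  map_add' f g := by
    ext x
    have hf : DifferentiableAt ℝ f.1 x := (CInf.contDiff f).differentiable (by simp) x
    have hg : DifferentiableAt ℝ g.1 x := (CInf.contDiff g).differentiable (by simp) x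
    simp [fderiv_add hf hg]
  map_smul' c f := by
    ext x
    have hf : DifferentiableAt ℝ f.1 x := (CInf.contDiff f).differentiable (by simp) x
    simp [fderiv_const_smul hf c]

/-- The partial derivative `∂^α = ∂_1^{α_1} ⋯ ∂_N^{α_N}` on `C^∞(ℝ^N)`. -/
def mderiv {N : ℕ} (α : Fin N → ℕ) : Module.End ℂ (CInf N) :=
  ((List.finRange N).map (fun i => pderiv i ^ α i)).prod

/-- The length `|α|` of a multi-index. -/
def mlen {N : ℕ} (α : Fin N → ℕ) : ℕ := ∑ i, α i

section Weighted

variable {N : ℕ}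

/-- The function `(α, x) ↦ v(α, x) |∂^α f(x)|`. -/
def weighted (v : (Fin N → ℕ) → Eucl N → ℝ) (f : CInf N) (p : (Fin N → ℕ) × Eucl N) : ℝ :=
  v p.1 p.2 * ‖(mderiv p.1 f).1 p.2‖

/-- The smooth functions `f` with `sup_{α, x} v(α, x) |∂^α f(x)| < ∞`, for a weight `v ≥ 0`. -/
def weightedSpace (v : (Fin N → ℕ) → Eucl N → ℝ) (hv : ∀ α x, 0 ≤ v α x) :
    Submodule ℂ (CInf N) where
  carrier := {f | BddAbove (Set.range (weighted v f))}
  zero_mem' := ⟨0, by rintro _ ⟨p, rfl⟩; simp [weighted]⟩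
  add_mem' := by
    rintro f g ⟨C, hC⟩ ⟨D, hD⟩
    refine ⟨C + D, ?_⟩
    rintro _ ⟨p, rfl⟩
    have h1 := hC ⟨p, rfl⟩
    have h2 := hD ⟨p, rfl⟩
    have h3 := mul_le_mul_of_nonneg_left
      (norm_add_le ((mderiv p.1 f).1 p.2) ((mderiv p.1 g).1 p.2)) (hv p.1 p.2)
    simp only [weighted, map_add, Submodule.coe_add, Pi.add_apply] at *
    linarith
  smul_mem' := by
    rintro c f ⟨C, hC⟩
    refine ⟨‖c‖ * C, ?_⟩
    rintro _ ⟨p, rfl⟩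
    have h1 := mul_le_mul_of_nonneg_left (hC ⟨p, rfl⟩) (norm_nonneg c)
    simp only [weighted, map_smul, Submodule.coe_smul, Pi.smul_apply, norm_smul] at *
    linarith

/-- The seminorm `f ↦ sup_{α, x} v(α, x) |∂^α f(x)|` on the space where it is finite. -/
def weightedSeminorm (v : (Fin N → ℕ) → Eucl N → ℝ) (hv : ∀ α x, 0 ≤ v α x) :
    Seminorm ℂ (weightedSpace v hv) :=
  Seminorm.of (fun f => ⨆ p, weighted v f.1 p)
    (by
      intro f g
      refine ciSup_le fun p => ?_
      refine le_trans ?_ (add_le_add (le_ciSup f.2 p) (le_ciSup g.2 p))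
      have h3 := mul_le_mul_of_nonneg_left
        (norm_add_le ((mderiv p.1 f.1).1 p.2) ((mderiv p.1 g.1).1 p.2)) (hv p.1 p.2)
      simp only [weighted, map_add, Submodule.coe_add, Pi.add_apply] at *
      linarith)
    (by
      intro c f
      rw [Real.mul_iSup_of_nonneg (norm_nonneg c)]
      congr 1
      ext p
      simp only [weighted, map_smul, Submodule.coe_smul, Pi.smul_apply, norm_smul]
      ring)

end Weighted

/-- The locally convex topology generated by a family of seminorms. -/
@[reducible] def seminormTopology {X ι : Type*} [AddCommGroup X] [Module ℂ X] [Nonempty ι]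
    (p : ι → Seminorm ℂ X) : TopologicalSpace X :=
  (SeminormFamily.moduleFilterBasis (𝕜 := ℂ) p).topology

/-- Given linear maps `j i : Y i → X` and topologies on the `Y i`, the inductive topology on `X`:
the finest locally convex vector space topology for which all `j i` are continuous. -/
@[reducible] def inductiveTopology {X ι : Type*} [AddCommGroup X] [Module ℂ X] [Module ℝ X]
    {Y : ι → Type*} [∀ i, AddCommGroup (Y i)] [∀ i, Module ℂ (Y i)]
    (TY : ∀ i, TopologicalSpace (Y i)) (j : ∀ i, Y i →ₗ[ℂ] X) : TopologicalSpace X :=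
  sInf {T | @IsTopologicalAddGroup X T _ ∧ @ContinuousSMul ℂ X _ _ T ∧
    @LocallyConvexSpace ℝ X _ _ _ _ T ∧ ∀ i, Continuous[TY i, T] (j i)}

variable (N : ℕ) (ω : WeightFunction)

/-! ### The spaces of slowly increasing functions of Beurling type -/

/-- The weight `exp (-n ω(x) - m φ*(|α|/m))`. -/
def stepWeight (m n : ℕ+) (α : Fin N → ℕ) (x : Eucl N) : ℝ :=
  Real.exp (-((n : ℝ) * ω.toFun ‖x‖)) * expNeg ω m (mlen α)

lemma stepWeight_nonneg (m n : ℕ+) (α : Fin N → ℕ) (x : Eucl N) : 0 ≤ stepWeight N ω m n α x :=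
  mul_nonneg (Real.exp_pos _).le (expNeg_nonneg ω m _)

/-- The space `O^m_{n,ω}(ℝ^N)`. -/
def stepSpace (m n : ℕ+) : Submodule ℂ (CInf N) :=
  weightedSpace (stepWeight N ω m n) (stepWeight_nonneg N ω m n)

/-- The norm `r_{m,n}` of `O^m_{n,ω}(ℝ^N)`. -/
def stepNorm (m n : ℕ+) : Seminorm ℂ (stepSpace N ω m n) :=
  weightedSeminorm (stepWeight N ω m n) (stepWeight_nonneg N ω m n)

/-- The norm topology of `O^m_{n,ω}(ℝ^N)`. -/
@[reducible] def stepTopology (m n : ℕ+) : TopologicalSpace (stepSpace N ω m n) :=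
  seminormTopology (fun _ : Unit => stepNorm N ω m n)

lemma stepSpace_mono (m : ℕ+) {n n' : ℕ+} (h : n ≤ n') :
    stepSpace N ω m n ≤ stepSpace N ω m n' := by
  rintro f ⟨C, hC⟩
  refine ⟨C, ?_⟩
  rintro _ ⟨p, rfl⟩
  refine le_trans ?_ (hC ⟨p, rfl⟩)
  have hnn : ((n : ℕ) : ℝ) ≤ ((n' : ℕ) : ℝ) := by exact_mod_cast h
  unfold weighted stepWeight
  gcongr
  · exact expNeg_nonneg ω m _
  · exact ω.nonneg _ (norm_nonneg _)

/-- The space `⋃_n O^m_{n,ω}(ℝ^N)`. -/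
def unionSpace (m : ℕ+) : Submodule ℂ (CInf N) where
  carrier := ⋃ n : ℕ+, (stepSpace N ω m n : Set (CInf N))
  zero_mem' := Set.mem_iUnion.2 ⟨1, zero_mem _⟩
  add_mem' := by
    intro f g hf hg
    obtain ⟨n, hn⟩ := Set.mem_iUnion.1 hf
    obtain ⟨k, hk⟩ := Set.mem_iUnion.1 hg
    exact Set.mem_iUnion.2 ⟨max n k, add_mem (stepSpace_mono N ω m (le_max_left n k) hn)
      (stepSpace_mono N ω m (le_max_right n k) hk)⟩
  smul_mem' := by
    intro c f hf
    obtain ⟨n, hn⟩ := Set.mem_iUnion.1 hf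
    exact Set.mem_iUnion.2 ⟨n, Submodule.smul_mem _ c hn⟩

lemma stepSpace_le (m n : ℕ+) : stepSpace N ω m n ≤ unionSpace N ω m :=
  fun _ hf => Set.mem_iUnion.2 ⟨n, hf⟩

/-- The inductive limit topology of `⋃_n O^m_{n,ω}(ℝ^N)`. -/
@[reducible] def unionTopology (m : ℕ+) : TopologicalSpace (unionSpace N ω m) :=
  inductiveTopology (fun n => stepTopology N ω m n)
    (fun n => Submodule.inclusion (stepSpace_le N ω m n))

/-- The space `O_{M,ω}(ℝ^N) = ⋂_m ⋃_n O^m_{n,ω}(ℝ^N)`. -/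
def OM : Submodule ℂ (CInf N) := ⨅ m : ℕ+, unionSpace N ω m

lemma OM_le (m : ℕ+) : OM N ω ≤ unionSpace N ω m := iInf_le _ m

/-- The topology `t` of `O_{M,ω}(ℝ^N)`: the projective topology, i.e. the coarsest topology for
which all inclusions into the spaces `⋃_n O^m_{n,ω}(ℝ^N)` are continuous. -/
@[reducible] def tTopology : TopologicalSpace (OM N ω) :=
  ⨅ m : ℕ+, TopologicalSpace.induced (Submodule.inclusion (OM_le N ω m)) (unionTopology N ω m)

/-! ### The space `S_ω(ℝ^N)` and the topology `τ` -/

/-- The Fourier transform `f̂(ξ) = ∫ f(x) e^{-i x ξ} dx`. -/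
def fourierTransform (f : Eucl N → ℂ) (ξ : Eucl N) : ℂ :=
  ∫ x, f x * Complex.exp (-(Complex.I * ((inner ℝ x ξ : ℝ) : ℂ)))

/-- `‖exp(λ ω) ∂^α f‖_∞ < ∞` for all `λ > 0` and all `α`. -/
def RapidDecay (f : CInf N) : Prop :=
  ∀ (l : ℝ), 0 < l → ∀ α : Fin N → ℕ,
    ∃ C : ℝ, ∀ x, Real.exp (l * ω.toFun ‖x‖) * ‖(mderiv α f).1 x‖ ≤ C

/-- The set `S_ω(ℝ^N)` of `ω`-ultradifferentiable rapidly decreasing functions of Beurling type: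
`f ∈ L^1`, `f` and `f̂` are smooth, and both decay rapidly together with all derivatives. -/
def Somega : Set (Eucl N → ℂ) :=
  {f | MeasureTheory.Integrable f ∧
    ∃ (hf : f ∈ CInf N) (hF : fourierTransform N f ∈ CInf N),
      RapidDecay N ω ⟨f, hf⟩ ∧ RapidDecay N ω ⟨fourierTransform N f, hF⟩}

lemma zero_mem_Somega : (0 : Eucl N → ℂ) ∈ Somega N ω := by
  have hF : fourierTransform N (0 : Eucl N → ℂ) = 0 := by
    ext ξ; simp [fourierTransform]
  have h0 : RapidDecay N ω (0 : CInf N) := fun l _ α => ⟨0, fun x => by simp⟩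
  refine ⟨MeasureTheory.integrable_zero _ _ _, zero_mem _, by rw [hF]; exact zero_mem _, h0, ?_⟩
  convert h0 using 1
  exact Subtype.ext hF

instance : Nonempty (ℕ+ × Somega N ω) := ⟨(1, ⟨0, zero_mem_Somega N ω⟩)⟩

/-- The weight `|g(x)| exp (-m φ*(|α|/m))`. -/
def multWeight (m : ℕ+) (g : Eucl N → ℂ) (α : Fin N → ℕ) (x : Eucl N) : ℝ :=
  ‖g x‖ * expNeg ω m (mlen α)

lemma multWeight_nonneg (m : ℕ+) (g : Eucl N → ℂ) (α : Fin N → ℕ) (x : Eucl N) :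
    0 ≤ multWeight N ω m g α x :=
  mul_nonneg (norm_nonneg _) (expNeg_nonneg ω m _)

lemma OM_le_weightedSpace (m : ℕ+) (g : Somega N ω) :
    OM N ω ≤ weightedSpace (multWeight N ω m g.1) (multWeight_nonneg N ω m g.1) := by
  intro f hf
  obtain ⟨n, C, hC⟩ := Set.mem_iUnion.1 (OM_le N ω m hf)
  obtain ⟨-, hg, -, hd, -⟩ := g.2
  obtain ⟨D, hD⟩ := hd (n : ℝ) (by exact_mod_cast n.pos) 0
  refine ⟨D * C, ?_⟩
  rintro _ ⟨⟨α, x⟩, rfl⟩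
  have h1 : stepWeight N ω m n α x * ‖(mderiv α f).1 x‖ ≤ C := hC ⟨(α, x), rfl⟩
  have h2 : Real.exp ((n : ℝ) * ω.toFun ‖x‖) * ‖g.1 x‖ ≤ D := by
    have := hD x
    simpa [mderiv] using this
  have h3 : weighted (multWeight N ω m g.1) f (α, x) =
      (Real.exp ((n : ℝ) * ω.toFun ‖x‖) * ‖g.1 x‖) *
        (stepWeight N ω m n α x * ‖(mderiv α f).1 x‖) := by
    have : Real.exp ((n : ℝ) * ω.toFun ‖x‖) * Real.exp (-((n : ℝ) * ω.toFun ‖x‖)) = 1 := by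
      rw [← Real.exp_add]; simp
    simp only [weighted, multWeight, stepWeight]
    linear_combination
      (-(‖g.1 x‖ * expNeg ω m (mlen α) * ‖(mderiv α f).1 x‖)) * this
  rw [h3]
  exact mul_le_mul h2 h1 (mul_nonneg (stepWeight_nonneg N ω m n α x) (norm_nonneg _))
    (le_trans (by positivity) h2)

/-- The seminorm `q_{m,g}(f) = sup_{α, x} |g(x)| |∂^α f(x)| exp (-m φ*(|α|/m))` on
`O_{M,ω}(ℝ^N)`. -/
def qSeminorm (i : ℕ+ × Somega N ω) : Seminorm ℂ (OM N ω) :=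
  (weightedSeminorm (multWeight N ω i.1 i.2.1) (multWeight_nonneg N ω i.1 i.2.1)).comp
    (Submodule.inclusion (OM_le_weightedSpace N ω i.1 i.2))

/-- The topology `τ` of `O_{M,ω}(ℝ^N)`, generated by the seminorms `q_{m,g}`, `m ∈ ℕ`,
`g ∈ S_ω(ℝ^N)`. -/
@[reducible] def tauTopology : TopologicalSpace (OM N ω) :=
  seminormTopology (qSeminorm N ω)

end OMomega

end

/-! Continuity: every `g` in `S_ω` satisfies `|g| ≤ D exp(-n ω)` for each `n`, so `q_{m,g} ≤ D
r_{m,n}` on every step. Hence `q_{m,g}` extends to a continuous seminorm on the inductive limit over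
`n` (`unionTopology_le`), and its restriction is `t`-continuous.

Bounded sets: the point is that a `τ`-bounded `B` is, for each `m`, norm bounded in a single step
(`exists_step_bound`); boundedness in the inductive limits, and so in `t`, follows. If this fails
for some `m`, there are `f_j ∈ B`, multi-indices `α_j` and points `y_j` at which the quantity
defining `r_{m,j+1}(f_j)` exceeds `4^j`. One `g ∈ S_ω` with `|g(y_j)| ≥ 2^{-j} exp(-j ω(y_j))` for
all `j` then gives `q_{m,g}(f_j) ≥ 2^j`, a contradiction.

Such a `g` is the sum of the Gaussians centred at `y_j` with these lower bounds as coefficients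
(`gaussSeries`). Positivity excludes cancellation. By (β) `ω` grows at most linearly, so Gaussians
beat `exp(l ω)`; (α) splits `ω(x)` into parts at `x - y_j` and `y_j`. In `ĝ` the translations become
modulations, whose derivatives cost powers of `|y_j|`, which the coefficients absorb by (γ). -/

namespace OMomega

open MeasureTheory

/-! ### Partial derivatives and the full iterated derivative -/

section Calculus

variable {N : ℕ}

lemma norm_iteratedFDeriv_pderiv_le (i : Fin N) (f : CInf N) (k : ℕ) (x : Eucl N) :
    ‖iteratedFDeriv ℝ k (pderiv i f).1 x‖ ≤ ‖iteratedFDeriv ℝ (k + 1) f.1 x‖ := by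
  have hf : ContDiff ℝ (⊤ : ℕ∞) (fderiv ℝ f.1) :=
    (CInf.contDiff f).fderiv_right (m := (⊤ : ℕ∞)) (by simp)
  have h := norm_iteratedFDeriv_clm_apply_const (n := k) (c := EuclideanSpace.single i (1 : ℝ))
    (hf.contDiffAt (x := x)) (by exact_mod_cast le_top)
  rw [norm_iteratedFDeriv_fderiv, PiLp.norm_single, norm_one, one_mul] at h
  exact h

lemma norm_iteratedFDeriv_pderiv_pow_le (i : Fin N) (n : ℕ) (f : CInf N) (k : ℕ) (x : Eucl N) :
    ‖iteratedFDeriv ℝ k ((pderiv i ^ n) f).1 x‖ ≤ ‖iteratedFDeriv ℝ (k + n) f.1 x‖ := by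
  induction n generalizing f with
  | zero => simp
  | succ n ih =>
    rw [pow_succ, Module.End.mul_apply]
    refine (ih _).trans ?_
    rw [← add_assoc]
    exact norm_iteratedFDeriv_pderiv_le i f (k + n) x

/-- Lets all decay estimates be made on full iterated derivatives, where the chain rule has clean
operator-norm bounds. -/
lemma norm_mderiv_le (α : Fin N → ℕ) (f : CInf N) (x : Eucl N) :
    ‖(mderiv α f).1 x‖ ≤ ‖iteratedFDeriv ℝ (mlen α) f.1 x‖ := by
  -- Peeling factors off the product raises the outer order `k`; keeping `n` free, tied by an
  -- equation, avoids rewriting the order inside `iteratedFDeriv`.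
  have key : ∀ (L : List (Fin N)) (k n : ℕ), n = k + (L.map α).sum →
      ‖iteratedFDeriv ℝ k ((L.map fun i => pderiv i ^ α i).prod f).1 x‖ ≤
        ‖iteratedFDeriv ℝ n f.1 x‖ := by
    intro L
    induction L with
    | nil =>
      rintro k n rfl
      exact le_rfl
    | cons i L ih =>
      intro k n hn
      rw [List.map_cons, List.sum_cons, ← add_assoc] at hn
      rw [List.map_cons, List.prod_cons, Module.End.mul_apply]
      exact (norm_iteratedFDeriv_pderiv_pow_le i (α i) _ k x).trans (ih _ n hn)
  have h := key (List.finRange N) 0 (mlen α)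
    (by rw [zero_add, ← List.ofFn_eq_map, List.sum_ofFn]; rfl)
  rwa [norm_iteratedFDeriv_zero] at h

/-- The real derivative of `exp` is `exp` followed by the multiplication map, which has norm at most
1. -/
lemma norm_iteratedFDeriv_cexp_le (k : ℕ) (z : ℂ) :
    ‖iteratedFDeriv ℝ k Complex.exp z‖ ≤ ‖Complex.exp z‖ := by
  induction k with
  | zero => simp
  | succ k ih =>
    have h : fderiv ℝ Complex.exp = ContinuousLinearMap.mul ℝ ℂ ∘ Complex.exp := by
      ext1 w
      have := ((Complex.hasDerivAt_exp w).hasFDerivAt.restrictScalars ℝ).fderiv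
      rw [this]
      ext
      simp [mul_comm]
    rw [← norm_iteratedFDeriv_fderiv, h]
    refine (ContinuousLinearMap.norm_iteratedFDeriv_comp_left _
      (Complex.contDiff_exp (𝕜 := ℝ) (n := k)).contDiffAt le_rfl).trans ?_
    refine le_trans ?_ ih
    exact mul_le_of_le_one_left (norm_nonneg _) (ContinuousLinearMap.opNorm_mul_le ℝ ℂ)

/-- The Gaussian modulated by the character with frequency `-y`. -/
noncomputable def gaussWave (y x : Eucl N) : ℂ :=
  Complex.exp (-(1 / 2 : ℂ) * (‖x‖ : ℂ) ^ 2 + -Complex.I * ((inner ℝ y x : ℝ) : ℂ))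

lemma norm_gaussWave (y x : Eucl N) : ‖gaussWave y x‖ = Real.exp (-(‖x‖ ^ 2 / 2)) := by
  rw [gaussWave, Complex.norm_exp]
  congr 1
  rw [← Complex.ofReal_pow]
  simp [Complex.mul_re, -Complex.ofReal_pow]
  ring

/-- The exponent of `gaussWave`. -/
noncomputable def gaussPhase (y x : Eucl N) : ℂ :=
  -(1 / 2 : ℂ) * (‖x‖ : ℂ) ^ 2 + -Complex.I * ((inner ℝ y x : ℝ) : ℂ)

/-- The linear part of the derivative of `gaussPhase`. -/
noncomputable def gaussPhaseLin (N : ℕ) : Eucl N →L[ℝ] (Eucl N →L[ℝ] ℂ) :=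
  (ContinuousLinearMap.compL ℝ (Eucl N) ℝ ℂ Complex.ofRealCLM).comp (innerSL ℝ)

lemma gaussPhaseLin_apply (x v : Eucl N) : gaussPhaseLin N x v = ((inner ℝ x v : ℝ) : ℂ) := rfl

lemma norm_gaussPhaseLin_apply_le (x : Eucl N) : ‖gaussPhaseLin N x‖ ≤ ‖x‖ := by
  refine ContinuousLinearMap.opNorm_le_bound _ (norm_nonneg _) fun v => ?_
  rw [gaussPhaseLin_apply, Complex.norm_real]
  exact norm_inner_le_norm x v

lemma norm_gaussPhaseLin_le : ‖gaussPhaseLin N‖ ≤ 1 :=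
  ContinuousLinearMap.opNorm_le_bound _ zero_le_one fun x => by
    simpa using norm_gaussPhaseLin_apply_le x

lemma gaussPhase_eq (y : Eucl N) : gaussPhase y = fun x =>
    (-(1 / 2 : ℝ)) • Complex.ofRealCLM (‖x‖ ^ 2) + (-Complex.I) • gaussPhaseLin N y x := by
  ext x
  simp [gaussPhase, gaussPhaseLin_apply]

lemma contDiff_gaussPhase (y : Eucl N) {n : WithTop ℕ∞} : ContDiff ℝ n (gaussPhase y) := by
  rw [gaussPhase_eq]
  exact ((Complex.ofRealCLM.contDiff.comp (contDiff_norm_sq ℝ)).const_smul _).add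
    ((gaussPhaseLin N y).contDiff.const_smul _)

lemma fderiv_gaussPhase (y : Eucl N) :
    fderiv ℝ (gaussPhase y) = fun x => (-gaussPhaseLin N) x + (-Complex.I) • gaussPhaseLin N y := by
  ext1 x
  rw [gaussPhase_eq]
  have h1 : HasFDerivAt (fun x : Eucl N => ‖x‖ ^ 2) (2 • innerSL ℝ x) x :=
    (hasStrictFDerivAt_norm_sq x).hasFDerivAt
  have h2 := ((Complex.ofRealCLM.hasFDerivAt.comp x h1).const_smul (-(1 / 2 : ℝ))).add
    ((gaussPhaseLin N y).hasFDerivAt (x := x) |>.const_smul (-Complex.I))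
  refine Eq.trans h2.fderiv ?_
  ext v
  simp [gaussPhaseLin_apply]

/-- The phase is quadratic: its first derivative is at most `|x| + |y|`, its second at most 1, and
the rest vanish. The form `D ^ i` with `D ≥ 1` is what the Faà di Bruno bound
`norm_iteratedFDeriv_comp_le` takes as input. -/
lemma norm_iteratedFDeriv_gaussPhase_le (y x : Eucl N) {i : ℕ} (hi : 1 ≤ i) :
    ‖iteratedFDeriv ℝ i (gaussPhase y) x‖ ≤ (2 + ‖x‖ + ‖y‖) ^ i := by
  have hD : 1 ≤ 2 + ‖x‖ + ‖y‖ := by linarith [norm_nonneg x, norm_nonneg y]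
  obtain ⟨j, rfl⟩ : ∃ j, i = j + 1 := ⟨i - 1, by omega⟩
  rw [← norm_iteratedFDeriv_fderiv, fderiv_gaussPhase]
  rcases j with _ | j
  · rw [norm_iteratedFDeriv_zero]
    refine (norm_add_le _ _).trans ?_
    rw [norm_smul]
    simp only [neg_apply, norm_neg, Complex.norm_I, one_mul, zero_add, pow_one]
    linarith [norm_gaussPhaseLin_apply_le x, norm_gaussPhaseLin_apply_le y]
  · rw [← norm_iteratedFDeriv_fderiv]
    have h : fderiv ℝ (fun x => (-gaussPhaseLin N) x + (-Complex.I) • gaussPhaseLin N y) =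
        fun _ => -gaussPhaseLin N := by
      ext1 x
      rw [fderiv_add_const]
      exact (-gaussPhaseLin N).fderiv
    rw [h]
    refine le_trans ?_ (one_le_pow₀ hD)
    rcases j with _ | j
    · rw [norm_iteratedFDeriv_zero, norm_neg]
      exact norm_gaussPhaseLin_le
    · rw [iteratedFDeriv_const_of_ne (by omega)]
      simp

lemma gaussWave_eq_comp (y : Eucl N) : gaussWave y = Complex.exp ∘ gaussPhase y := rfl

lemma contDiff_gaussWave (y : Eucl N) {n : WithTop ℕ∞} : ContDiff ℝ n (gaussWave y) :=
  Complex.contDiff_exp.comp (contDiff_gaussPhase y)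

lemma norm_iteratedFDeriv_gaussWave_le (k : ℕ) (y x : Eucl N) :
    ‖iteratedFDeriv ℝ k (gaussWave y) x‖ ≤
      k.factorial * Real.exp (-(‖x‖ ^ 2 / 2)) * (2 + ‖x‖ + ‖y‖) ^ k := by
  rw [gaussWave_eq_comp]
  refine norm_iteratedFDeriv_comp_le (N := k) Complex.contDiff_exp (contDiff_gaussPhase y) le_rfl x
    (fun i _ => ?_) fun i hi _ => norm_iteratedFDeriv_gaussPhase_le y x hi
  rw [← norm_gaussWave y x]
  exact norm_iteratedFDeriv_cexp_le i _

/-! ### Fourier transforms of translated Gaussians -/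

lemma integrable_gaussWave (y : Eucl N) : Integrable (gaussWave y) :=
  GaussianFourier.integrable_cexp_neg_mul_sq_norm_add (by norm_num) (-Complex.I) y

lemma integral_gaussWave (y : Eucl N) : ∫ x, gaussWave y x =
    (Real.pi / (1 / 2 : ℂ)) ^ (N / 2 : ℂ) * gaussWave 0 y := by
  have h := GaussianFourier.integral_cexp_neg_mul_sq_norm_add (b := 1 / 2) (by norm_num)
    (-Complex.I) y
  rw [finrank_euclideanSpace_fin] at h
  refine h.trans ?_
  congr 1
  simp only [gaussWave, inner_zero_left]
  congr 1
  simp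
  ring

/-- Translation turns into modulation, so the transform is again a multiple of a `gaussWave` and
obeys the same derivative bounds. -/
lemma fourierTransform_gauss_translate (y ξ : Eucl N) :
    ∫ x, gaussWave 0 (x - y) * Complex.exp (-(Complex.I * ((inner ℝ x ξ : ℝ) : ℂ))) =
      (Real.pi / (1 / 2 : ℂ)) ^ (N / 2 : ℂ) * gaussWave y ξ := by
  rw [← integral_add_right_eq_self _ y]
  have h : ∀ x : Eucl N, gaussWave 0 (x + y - y) *
      Complex.exp (-(Complex.I * ((inner ℝ (x + y) ξ : ℝ) : ℂ))) =
      Complex.exp (-(Complex.I * ((inner ℝ y ξ : ℝ) : ℂ))) * gaussWave ξ x := by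
    intro x
    simp only [gaussWave, add_sub_cancel_right, inner_zero_left, inner_add_left,
      real_inner_comm ξ x, ← Complex.exp_add]
    congr 1
    push_cast
    ring
  simp_rw [h]
  rw [integral_const_mul, integral_gaussWave, mul_left_comm]
  congr 1
  simp only [gaussWave, inner_zero_left, ← Complex.exp_add]
  congr 1
  push_cast
  ring

end Calculus

/-! ### Growth of the weight -/

namespace WeightFunction

variable (ω : WeightFunction)

/-- Condition (β) forces at most linear growth. -/
lemma exists_le_linear : ∃ C : ℝ, 0 ≤ C ∧ ∀ t, 0 ≤ t → ω.toFun t ≤ C * (1 + t) := by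
  set I := ∫ s in Set.Ioi (1 : ℝ), ω.toFun s / (1 + s ^ 2)
  have hI : 0 ≤ I := setIntegral_nonneg measurableSet_Ioi fun s hs =>
    div_nonneg (ω.nonneg s (zero_le_one.trans (le_of_lt hs))) (by positivity)
  have h1 : 0 ≤ ω.toFun 1 := ω.nonneg 1 zero_le_one
  refine ⟨ω.toFun 1 + 5 * I, by positivity, fun t ht => ?_⟩
  rcases le_total t 1 with ht1 | ht1
  · have := ω.monotoneOn (Set.mem_Ici.2 ht) (Set.mem_Ici.2 zero_le_one) ht1
    nlinarith [mul_nonneg h1 ht, mul_nonneg hI ht]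
  have hωt := ω.nonneg t ht
  -- On `(t, 2t]` monotonicity bounds the integrand below by `ω(t) / (1 + 4t²)`. Integrating, and
  -- using `1 + 4t² ≤ 5t²` for `t ≥ 1`, gives `ω(t) ≤ 5 I t`.
  have hsub : Set.Ioc t (2 * t) ⊆ Set.Ioi 1 := fun s hs => lt_of_le_of_lt ht1 hs.1
  have hint : IntegrableOn (fun s : ℝ => ω.toFun s / (1 + s ^ 2)) (Set.Ioc t (2 * t)) :=
    ω.integrable.mono_set hsub
  have hle : ∫ s in Set.Ioc t (2 * t), ω.toFun s / (1 + s ^ 2) ≤ I :=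
    setIntegral_mono_set ω.integrable
      ((ae_restrict_iff' measurableSet_Ioi).2 (Filter.Eventually.of_forall fun s hs =>
        div_nonneg (ω.nonneg s (zero_le_one.trans (le_of_lt hs))) (by positivity)))
      hsub.eventuallyLE
  have hge : ∫ _ in Set.Ioc t (2 * t), ω.toFun t / (1 + (2 * t) ^ 2) ≤
      ∫ s in Set.Ioc t (2 * t), ω.toFun s / (1 + s ^ 2) := by
    refine setIntegral_mono_on (by simp) hint measurableSet_Ioc fun s hs => ?_
    have hs0 : 0 ≤ s := ht.trans hs.1.le
    have h2 := ω.monotoneOn (Set.mem_Ici.2 ht) (Set.mem_Ici.2 hs0) hs.1.le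
    have h3 := hs.2
    gcongr
    exact ω.nonneg s hs0
  have hc : ∫ _ in Set.Ioc t (2 * t), ω.toFun t / (1 + (2 * t) ^ 2) =
      t * (ω.toFun t / (1 + (2 * t) ^ 2)) := by
    rw [setIntegral_const, smul_eq_mul, Real.volume_real_Ioc_of_le (by linarith)]
    ring
  have h4 : t * (ω.toFun t / (1 + (2 * t) ^ 2)) ≤ I := hc ▸ hge.trans hle
  rw [mul_div_assoc', div_le_iff₀ (by positivity)] at h4
  have h5 : t * ω.toFun t ≤ t * (I * (5 * t)) := by nlinarith [mul_nonneg hI ht]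
  have h6 := le_of_mul_le_mul_left h5 (by linarith)
  nlinarith [mul_nonneg h1 ht]

/-- Condition (α) controls the weight of a sum. -/
lemma exists_add_le : ∃ K : ℝ, 1 ≤ K ∧ ∀ s t, 0 ≤ s → 0 ≤ t →
    ω.toFun (s + t) ≤ K * (1 + ω.toFun s + ω.toFun t) := by
  obtain ⟨K, hK, h⟩ := ω.doubling
  have key : ∀ s t, 0 ≤ s → s ≤ t → ω.toFun (s + t) ≤ K * (1 + ω.toFun t) := fun s t hs hst =>
    (ω.monotoneOn (Set.mem_Ici.2 (by linarith)) (Set.mem_Ici.2 (by linarith))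
      (by linarith : s + t ≤ 2 * t)).trans (h t (hs.trans hst))
  refine ⟨K, hK, fun s t hs ht => ?_⟩
  have h1 := ω.nonneg s hs
  have h2 := ω.nonneg t ht
  rcases le_total s t with hst | hst
  · nlinarith [key s t hs hst]
  · rw [add_comm s t]
    nlinarith [key t s ht hst]

/-- Condition (γ): powers are dominated by exponentials of the weight. -/
lemma exists_pow_le (k : ℕ) : ∃ l C : ℝ, 0 < l ∧ 0 ≤ C ∧ ∀ t, 0 ≤ t →
    (2 + t) ^ k ≤ C * Real.exp (l * ω.toFun t) := by
  obtain ⟨a, b, hb, h⟩ := ω.log_le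
  -- `k / b` would suffice for the estimate; `k + 1` keeps the exponent positive when `k = 0`.
  refine ⟨(k + 1) / b, 2 ^ k * Real.exp (k * (-a / b)), by positivity, by positivity,
    fun t ht => ?_⟩
  have h1 : 1 + t ≤ Real.exp ((ω.toFun t - a) / b) := by
    rw [← Real.log_le_iff_le_exp (by linarith), le_div_iff₀ hb]
    linarith [h t ht]
  have h2 : (2 + t) ^ k ≤ 2 ^ k * (1 + t) ^ k := by
    rw [← mul_pow]
    gcongr
    linarith
  refine h2.trans ?_
  rw [mul_assoc, ← Real.exp_add]
  gcongr
  refine (pow_le_pow_left₀ (by linarith) h1 k).trans ?_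
  rw [← Real.exp_nat_mul]
  gcongr
  have h3 : 0 ≤ ω.toFun t / b := div_nonneg (ω.nonneg t ht) hb.le
  have h4 : k * ((ω.toFun t - a) / b) = k * (-a / b) + k * (ω.toFun t / b) := by ring
  have h5 : (k + 1) / b * ω.toFun t = k * (ω.toFun t / b) + ω.toFun t / b := by ring
  linarith

end WeightFunction

/-! ### Construction of elements of `S_ω` from Gaussians -/

section Series

variable {N : ℕ} {ω : WeightFunction}

/-- A series of smooth functions with summable weighted bounds on all derivatives is smooth and
rapidly decreasing. -/
lemma rapidDecay_tsum {u : ℕ → Eucl N → ℂ} (hu : ∀ j, ContDiff ℝ (⊤ : ℕ∞) (u j))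
    (hb : ∀ (k : ℕ) (l : ℝ), 0 < l → ∃ v : ℕ → ℝ, Summable v ∧
      ∀ j x, Real.exp (l * ω.toFun ‖x‖) * ‖iteratedFDeriv ℝ k (u j) x‖ ≤ v j) :
    ∃ h : (fun x => ∑' j, u j x) ∈ CInf N, RapidDecay N ω ⟨fun x => ∑' j, u j x, h⟩ := by
  -- Since `exp ω ≥ 1`, the bounds for `l = 1` are also the unweighted ones needed for termwise
  -- differentiation.
  choose v hv hvb using fun k => hb k 1 one_pos
  have hbound : ∀ (k i : ℕ) (x : Eucl N), ‖iteratedFDeriv ℝ k (u i) x‖ ≤ v k i := fun k i x =>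
    (le_mul_of_one_le_left (norm_nonneg _) (Real.one_le_exp
      (mul_nonneg zero_le_one (ω.nonneg _ (norm_nonneg x))))).trans (hvb k i x)
  have h : (fun x => ∑' j, u j x) ∈ CInf N :=
    contDiff_tsum hu (fun k _ => hv k) fun k i x _ => hbound k i x
  refine ⟨h, fun l hl α => ?_⟩
  obtain ⟨w, hw, hwb⟩ := hb (mlen α) l hl
  refine ⟨∑' j, w j, fun x => ?_⟩
  refine (mul_le_mul_of_nonneg_left (norm_mderiv_le α _ x) (Real.exp_pos _).le).trans ?_
  rw [iteratedFDeriv_tsum_apply (N := ⊤) hu (fun k _ => hv k) (fun k i x _ => hbound k i x) le_top]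
  have hs : Summable fun j => ‖iteratedFDeriv ℝ (mlen α) (u j) x‖ :=
    (hv (mlen α)).of_nonneg_of_le (fun _ => norm_nonneg _) fun j => hbound _ j x
  refine (mul_le_mul_of_nonneg_left (norm_tsum_le_tsum_norm hs) (Real.exp_pos _).le).trans ?_
  rw [← tsum_mul_left]
  exact (hs.mul_left _).tsum_le_tsum (fun j => hwb j x) hw

/-- By (γ) the decay dominates `(1 + |x|)^{-(N+1)}`, which is integrable in dimension `N`. -/
lemma RapidDecay.integrable {f : CInf N} (hf : RapidDecay N ω f) : Integrable f.1 := by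
  obtain ⟨l, C, hl, hC, hp⟩ := ω.exists_pow_le (N + 1)
  obtain ⟨D, hD⟩ := hf l hl 0
  have hi : Integrable fun x : Eucl N => (1 + ‖x‖) ^ (-((N + 1 : ℕ) : ℝ)) :=
    integrable_one_add_norm (by rw [finrank_euclideanSpace_fin]; push_cast; linarith)
  refine (hi.const_mul (C * D)).mono' (CInf.contDiff f).continuous.aestronglyMeasurable
    (Filter.Eventually.of_forall fun x => ?_)
  have hx : Real.exp (l * ω.toFun ‖x‖) * ‖f.1 x‖ ≤ D := by simpa [mderiv] using hD x
  have h1 : (1 + ‖x‖) ^ (N + 1) ≤ C * Real.exp (l * ω.toFun ‖x‖) :=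
    (pow_le_pow_left₀ (by positivity) (by linarith) _).trans (hp ‖x‖ (norm_nonneg x))
  rw [Real.rpow_neg (by positivity), Real.rpow_natCast, ← div_eq_mul_inv,
    le_div_iff₀ (by positivity)]
  calc ‖f.1 x‖ * (1 + ‖x‖) ^ (N + 1) ≤ ‖f.1 x‖ * (C * Real.exp (l * ω.toFun ‖x‖)) := by gcongr
    _ = C * (Real.exp (l * ω.toFun ‖x‖) * ‖f.1 x‖) := by ring
    _ ≤ C * D := by gcongr

-- Linear growth of `ω` makes `exp(l ω)` at most exponential, so the Gaussian wins; the modulation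
-- `y` costs only a polynomial factor.
variable (ω) in
lemma exists_gaussWave_decay (N k : ℕ) {l : ℝ} (hl : 0 ≤ l) : ∃ C : ℝ, 0 ≤ C ∧ ∀ y x : Eucl N,
    Real.exp (l * ω.toFun ‖x‖) * ‖iteratedFDeriv ℝ k (gaussWave y) x‖ ≤ C * (2 + ‖y‖) ^ k := by
  obtain ⟨A, hA, h⟩ := ω.exists_le_linear
  set c := l * A
  -- One factorial comes from the chain rule, the other from `(2 + r)^k ≤ k! exp(2 + r)`. The
  -- exponent is the maximum over `r` of `c(1 + r) + (2 + r) - r²/2`, attained at `r = 1 + c`.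
  refine ⟨k.factorial * (k.factorial * Real.exp (2 + c + (1 + c) ^ 2 / 2)), by positivity,
    fun y x => ?_⟩
  have hr := norm_nonneg x
  have hy := norm_nonneg y
  set r := ‖x‖
  have h1 : (2 + r) ^ k ≤ k.factorial * Real.exp (2 + r) := by
    have := Real.pow_div_factorial_le_exp (2 + r) (by linarith) k
    rwa [div_le_iff₀ (by positivity), mul_comm] at this
  have h2 : (2 + r + ‖y‖) ^ k ≤ (2 + r) ^ k * (2 + ‖y‖) ^ k := by
    rw [← mul_pow]
    gcongr
    nlinarith [mul_nonneg hr hy]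
  have h3 : Real.exp (l * ω.toFun r) * Real.exp (-(r ^ 2 / 2)) * Real.exp (2 + r) ≤
      Real.exp (2 + c + (1 + c) ^ 2 / 2) := by
    rw [← Real.exp_add, ← Real.exp_add]
    refine Real.exp_le_exp.2 ?_
    have := mul_le_mul_of_nonneg_left (h r hr) hl
    nlinarith [sq_nonneg (r - (1 + c)), (by ring : l * (A * (1 + r)) = c * (1 + r))]
  calc Real.exp (l * ω.toFun r) * ‖iteratedFDeriv ℝ k (gaussWave y) x‖
      ≤ Real.exp (l * ω.toFun r) * (k.factorial * Real.exp (-(r ^ 2 / 2)) *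
          ((k.factorial * Real.exp (2 + r)) * (2 + ‖y‖) ^ k)) := by
        refine mul_le_mul_of_nonneg_left ((norm_iteratedFDeriv_gaussWave_le k y x).trans ?_)
          (Real.exp_pos _).le
        refine mul_le_mul_of_nonneg_left (h2.trans ?_) (by positivity)
        gcongr
    _ = k.factorial * (k.factorial * (Real.exp (l * ω.toFun r) * Real.exp (-(r ^ 2 / 2)) *
          Real.exp (2 + r))) * (2 + ‖y‖) ^ k := by ring
    _ ≤ _ := by gcongr

/-- The coefficient with which the Gaussian centred at the `j`-th point enters `gaussSeries`. -/
noncomputable def peakCoeff (ω : WeightFunction) (y : ℕ → Eucl N) (j : ℕ) : ℝ :=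
  (1 / 2) ^ j * Real.exp (-(j * ω.toFun ‖y j‖))

lemma peakCoeff_pos (y : ℕ → Eucl N) (j : ℕ) : 0 < peakCoeff ω y j :=
  mul_pos (by positivity) (Real.exp_pos _)

/-- Once `j ≥ l`, the factor `exp(-j ω(y_j))` absorbs `exp(l ω(y_j))` and leaves `2^{-j}`, wherever
the points lie. -/
lemma summable_peakCoeff_mul_exp (y : ℕ → Eucl N) (l : ℝ) :
    Summable fun j => peakCoeff ω y j * Real.exp (l * ω.toFun ‖y j‖) := by
  refine Summable.of_norm_bounded_eventually_nat (g := fun j : ℕ => (1 / 2 : ℝ) ^ j)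
    summable_geometric_two ?_
  obtain ⟨n, hn⟩ := exists_nat_ge l
  filter_upwards [Filter.eventually_ge_atTop n] with j hj
  have hω := ω.nonneg _ (norm_nonneg (y j))
  have hlj : l ≤ j := hn.trans (by exact_mod_cast hj)
  rw [Real.norm_of_nonneg (mul_nonneg (peakCoeff_pos y j).le (Real.exp_pos _).le), peakCoeff,
    mul_assoc, ← Real.exp_add]
  refine mul_le_of_le_one_right (by positivity) (Real.exp_le_one_iff.2 ?_)
  nlinarith

lemma summable_peakCoeff (y : ℕ → Eucl N) : Summable (peakCoeff ω y) := by
  simpa using summable_peakCoeff_mul_exp (ω := ω) y 0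

lemma summable_peakCoeff_mul_pow (y : ℕ → Eucl N) (k : ℕ) :
    Summable fun j => peakCoeff ω y j * (2 + ‖y j‖) ^ k := by
  obtain ⟨l, C, -, hC, h⟩ := ω.exists_pow_le k
  refine ((summable_peakCoeff_mul_exp (ω := ω) y l).mul_left C).of_nonneg_of_le
    (fun j => mul_nonneg (peakCoeff_pos y j).le (by positivity)) fun j => ?_
  rw [mul_left_comm]
  exact mul_le_mul_of_nonneg_left (h _ (norm_nonneg _)) (peakCoeff_pos y j).le

lemma contDiff_gaussWave_sub (y : Eucl N) {n : WithTop ℕ∞} :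
    ContDiff ℝ n fun x => gaussWave 0 (x - y) :=
  (contDiff_gaussWave 0).comp (contDiff_id.sub contDiff_const)

/-- A superposition of Gaussians centred at the points `y j`. -/
noncomputable def gaussSeries (ω : WeightFunction) (y : ℕ → Eucl N) (x : Eucl N) : ℂ :=
  ∑' j, peakCoeff ω y j • gaussWave 0 (x - y j)

/-- By (α), `exp(l ω(x))` splits into a factor at `x - y_j`, absorbed by the Gaussian, and one at
`y_j`, absorbed by the coefficient. -/
lemma gaussSeries_rapidDecay (y : ℕ → Eucl N) :
    ∃ h : gaussSeries ω y ∈ CInf N, RapidDecay N ω ⟨gaussSeries ω y, h⟩ := by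
  refine rapidDecay_tsum (fun j => (contDiff_gaussWave_sub (y j)).const_smul _) fun k l hl => ?_
  obtain ⟨K, hK, hadd⟩ := ω.exists_add_le
  obtain ⟨C, hC, hdec⟩ := exists_gaussWave_decay ω N k (l := l * K) (by positivity)
  refine ⟨_, (summable_peakCoeff_mul_exp (ω := ω) y (l * K)).mul_left
    (Real.exp (l * K) * (C * 2 ^ k)), fun j x => ?_⟩
  rw [iteratedFDeriv_const_smul_apply' (contDiff_gaussWave_sub (y j)).contDiffAt,
    iteratedFDeriv_comp_sub, norm_smul, Real.norm_of_nonneg (peakCoeff_pos y j).le]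
  have h1 : ω.toFun ‖x‖ ≤ K * (1 + ω.toFun ‖x - y j‖ + ω.toFun ‖y j‖) := by
    refine le_trans (ω.monotoneOn (norm_nonneg _) (Set.mem_Ici.2 (by positivity)) ?_)
      (hadd _ _ (norm_nonneg (x - y j)) (norm_nonneg (y j)))
    simpa using norm_add_le (x - y j) (y j)
  have h2 : Real.exp (l * ω.toFun ‖x‖) ≤ Real.exp (l * K) *
      Real.exp (l * K * ω.toFun ‖x - y j‖) * Real.exp (l * K * ω.toFun ‖y j‖) := by
    rw [← Real.exp_add, ← Real.exp_add]
    gcongr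
    have := mul_le_mul_of_nonneg_left h1 hl.le
    linarith
  have h3 := hdec 0 (x - y j)
  rw [norm_zero, add_zero] at h3
  have hc := (peakCoeff_pos (ω := ω) y j).le
  calc Real.exp (l * ω.toFun ‖x‖) *
        (peakCoeff ω y j * ‖iteratedFDeriv ℝ k (gaussWave 0) (x - y j)‖)
      ≤ (Real.exp (l * K) * Real.exp (l * K * ω.toFun ‖x - y j‖) *
          Real.exp (l * K * ω.toFun ‖y j‖)) *
        (peakCoeff ω y j * ‖iteratedFDeriv ℝ k (gaussWave 0) (x - y j)‖) := by gcongr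
    _ = Real.exp (l * K) * (Real.exp (l * K * ω.toFun ‖x - y j‖) *
          ‖iteratedFDeriv ℝ k (gaussWave 0) (x - y j)‖) *
          (peakCoeff ω y j * Real.exp (l * K * ω.toFun ‖y j‖)) := by ring
    _ ≤ _ := by gcongr

lemma fourierTransform_gaussSeries (y : ℕ → Eucl N) :
    fourierTransform N (gaussSeries ω y) = fun ξ => ∑' j,
      (peakCoeff ω y j * (Real.pi / (1 / 2 : ℂ)) ^ (N / 2 : ℂ)) • gaussWave (y j) ξ := by
  ext ξ
  set F : ℕ → Eucl N → ℂ := fun j x => (peakCoeff ω y j : ℂ) * (gaussWave 0 (x - y j) *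
    Complex.exp (-(Complex.I * ((inner ℝ x ξ : ℝ) : ℂ)))) with hF
  have hnorm : ∀ j x, ‖F j x‖ = peakCoeff ω y j * ‖gaussWave 0 (x - y j)‖ := by
    intro j x
    have h1 : ‖Complex.exp (-(Complex.I * ((inner ℝ x ξ : ℝ) : ℂ)))‖ = 1 := by
      rw [Complex.norm_exp]
      simp
    rw [hF, norm_mul, norm_mul, h1, mul_one, Complex.norm_real,
      Real.norm_of_nonneg (peakCoeff_pos y j).le]
  have hint : ∀ j, Integrable (F j) := by
    intro j
    refine Integrable.mono'
      ((((integrable_gaussWave (N := N) 0).comp_sub_right (y j)).norm).const_mul (peakCoeff ω y j))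
      (Continuous.aestronglyMeasurable ?_) (Filter.Eventually.of_forall fun x => (hnorm j x).le)
    have := (contDiff_gaussWave_sub (n := 0) (y j)).continuous
    fun_prop
  have hsum : Summable fun j => ∫ x, ‖F j x‖ := by
    have : ∀ j, ∫ x, ‖F j x‖ = peakCoeff ω y j * ∫ x : Eucl N, ‖gaussWave 0 x‖ := by
      intro j
      simp_rw [hnorm]
      rw [integral_const_mul, integral_sub_right_eq_self (fun x : Eucl N => ‖gaussWave 0 x‖)]
    simp_rw [this]
    exact (summable_peakCoeff y).mul_right _
  have h := (hasSum_integral_of_summable_integral_norm hint hsum).tsum_eq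
  have hl : fourierTransform N (gaussSeries ω y) ξ = ∫ x, ∑' j, F j x := by
    refine integral_congr_ae (Filter.Eventually.of_forall fun x => ?_)
    simp only [gaussSeries, hF, ← tsum_mul_right, Complex.real_smul, mul_assoc]
  rw [hl, ← h]
  refine tsum_congr fun j => ?_
  rw [hF, integral_const_mul, fourierTransform_gauss_translate, smul_eq_mul, mul_assoc]

/-- All transformed Gaussians are centred at 0; `y_j` enters only through the factor `(2 +
|y_j|)^k`, which the coefficients absorb. -/
lemma fourierTransform_gaussSeries_rapidDecay (y : ℕ → Eucl N) :
    ∃ h : fourierTransform N (gaussSeries ω y) ∈ CInf N,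
      RapidDecay N ω ⟨fourierTransform N (gaussSeries ω y), h⟩ := by
  rw [fourierTransform_gaussSeries]
  set c : ℂ := (Real.pi / (1 / 2 : ℂ)) ^ (N / 2 : ℂ)
  refine rapidDecay_tsum (fun j => (contDiff_gaussWave (y j)).const_smul _) fun k l hl => ?_
  obtain ⟨C, hC, hdec⟩ := exists_gaussWave_decay ω N k hl.le
  refine ⟨_, (summable_peakCoeff_mul_pow (ω := ω) y k).mul_left (‖c‖ * C), fun j x => ?_⟩
  rw [iteratedFDeriv_const_smul_apply' (contDiff_gaussWave (y j)).contDiffAt, norm_smul, norm_mul,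
    Complex.norm_real, Real.norm_of_nonneg (peakCoeff_pos y j).le]
  have hc := (peakCoeff_pos (ω := ω) y j).le
  calc Real.exp (l * ω.toFun ‖x‖) *
        (peakCoeff ω y j * ‖c‖ * ‖iteratedFDeriv ℝ k (gaussWave (y j)) x‖)
      = peakCoeff ω y j * ‖c‖ * (Real.exp (l * ω.toFun ‖x‖) *
        ‖iteratedFDeriv ℝ k (gaussWave (y j)) x‖) := by ring
    _ ≤ peakCoeff ω y j * ‖c‖ * (C * (2 + ‖y j‖) ^ k) :=
        mul_le_mul_of_nonneg_left (hdec (y j) x) (by positivity)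
    _ = _ := by ring

lemma gaussSeries_mem_Somega (y : ℕ → Eucl N) : gaussSeries ω y ∈ Somega N ω := by
  obtain ⟨h, hd⟩ := gaussSeries_rapidDecay (ω := ω) y
  obtain ⟨h', hd'⟩ := fourierTransform_gaussSeries_rapidDecay (ω := ω) y
  exact ⟨hd.integrable, h, h', hd, hd'⟩

lemma gaussWave_zero_eq (x : Eucl N) :
    gaussWave 0 x = ((Real.exp (-(‖x‖ ^ 2 / 2)) : ℝ) : ℂ) := by
  simp only [gaussWave, inner_zero_left]
  push_cast
  congr 1
  ring

/-- All summands are nonnegative, so the `j`-th one at its own centre is a lower bound, even if the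
points repeat or cluster. -/
lemma peakCoeff_le_norm_gaussSeries (y : ℕ → Eucl N) (j : ℕ) :
    peakCoeff ω y j ≤ ‖gaussSeries ω y (y j)‖ := by
  set G : ℕ → ℝ := fun i => peakCoeff ω y i * Real.exp (-(‖y j - y i‖ ^ 2 / 2)) with hG
  have h0 : ∀ i, 0 ≤ G i := fun i => mul_nonneg (peakCoeff_pos y i).le (Real.exp_pos _).le
  have h1 : gaussSeries ω y (y j) = ((∑' i, G i : ℝ) : ℂ) := by
    rw [Complex.ofReal_tsum]
    refine tsum_congr fun i => ?_
    rw [gaussWave_zero_eq, hG, Complex.real_smul, Complex.ofReal_mul]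
  have h2 : Summable G := (summable_peakCoeff y).of_nonneg_of_le h0 fun i =>
    mul_le_of_le_one_right (peakCoeff_pos y i).le (Real.exp_le_one_iff.2 (by
      have : 0 ≤ ‖y j - y i‖ ^ 2 / 2 := by positivity
      linarith))
  rw [h1, Complex.norm_real, Real.norm_of_nonneg (tsum_nonneg h0)]
  refine le_trans (le_of_eq ?_) (h2.le_tsum j fun i _ => h0 i)
  simp [hG]

end Series

/-! ### Comparison of the topologies -/

lemma withSeminorms_seminormTopology {X ι : Type*} [AddCommGroup X] [Module ℂ X] [Nonempty ι]
    (p : ι → Seminorm ℂ X) : WithSeminorms (topology := seminormTopology p) p :=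
  @WithSeminorms.mk _ _ _ _ _ _ p (seminormTopology p) rfl

/-- Reduces the comparison of `t` with `τ` to one seminorm at a time. -/
lemma seminormTopology_eq_iInf {X ι : Type*} [AddCommGroup X] [Module ℂ X] [Nonempty ι]
    (p : ι → Seminorm ℂ X) : seminormTopology p = ⨅ i, seminormTopology fun _ : Unit => p i := by
  have key : ∀ {κ : Type _} [Nonempty κ] (q : κ → Seminorm ℂ X), seminormTopology q =
      ⨅ i, (q i).toSeminormedAddCommGroup.toUniformSpace.toTopologicalSpace := by
    intro κ _ q
    let _ := seminormTopology q
    have := (withSeminorms_seminormTopology q).topologicalAddGroup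
    exact (SeminormFamily.withSeminorms_iff_topologicalSpace_eq_iInf q).1
      (withSeminorms_seminormTopology q)
  rw [key]
  refine iInf_congr fun i => ?_
  let _ := seminormTopology fun _ : Unit => p i
  have := (withSeminorms_seminormTopology fun _ : Unit => p i).topologicalAddGroup
  have := (SeminormFamily.withSeminorms_iff_topologicalSpace_eq_iInf fun _ : Unit => p i).1
    (withSeminorms_seminormTopology _)
  exact (iInf_const.symm.trans this.symm)

lemma seminormTopology_induced {X Y : Type*} [AddCommGroup X] [Module ℂ X] [AddCommGroup Y]
    [Module ℂ Y] (p : Seminorm ℂ Y) (f : X →ₗ[ℂ] Y) :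
    TopologicalSpace.induced f (seminormTopology fun _ : Unit => p) =
      seminormTopology fun _ : Unit => p.comp f := by
  let _ := seminormTopology fun _ : Unit => p
  let _ : TopologicalSpace X := TopologicalSpace.induced f inferInstance
  exact (LinearMap.withSeminorms_induced
    (withSeminorms_seminormTopology fun _ : Unit => p) f).topology_eq_withSeminorms

lemma isVonNBounded_image {X Y : Type*} [AddCommGroup X] [Module ℂ X] [AddCommGroup Y] [Module ℂ Y]
    (TX : TopologicalSpace X) (TY : TopologicalSpace Y) (f : X →ₗ[ℂ] Y) (hf : Continuous f)
    {B : Set X} (hB : Bornology.IsVonNBounded ℂ B) : Bornology.IsVonNBounded ℂ (f '' B) :=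
  hB.image (⟨f, hf⟩ : X →L[ℂ] Y)

/-- Boundedness of `B` means that `c • B` tends to the small sets of `𝓝 0` as `c → 0`; this form
passes through infima and pullbacks without asking the topologies to be linear. -/
lemma isVonNBounded_iInf_induced {X ι : Type*} [AddCommGroup X] [Module ℂ X] [Nonempty ι]
    {Y : ι → Type*} [∀ i, AddCommGroup (Y i)] [∀ i, Module ℂ (Y i)]
    (T : ∀ i, TopologicalSpace (Y i)) (j : ∀ i, X →ₗ[ℂ] Y i) {B : Set X}
    (hB : ∀ i, Bornology.IsVonNBounded ℂ (j i '' B)) :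
    @Bornology.IsVonNBounded ℂ X _ _ _ (⨅ i, TopologicalSpace.induced (j i) (T i)) B := by
  let _ : TopologicalSpace X := ⨅ i, TopologicalSpace.induced (j i) (T i)
  rw [Bornology.isVonNBounded_iff_tendsto_smallSets_nhds, nhds_iInf, Filter.smallSets_iInf]
  refine Filter.tendsto_iInf.2 fun i => ?_
  rw [nhds_induced, map_zero, Filter.smallSets_comap_eq_comap_image, Filter.tendsto_comap_iff]
  have h := Bornology.isVonNBounded_iff_tendsto_smallSets_nhds.1 (hB i)
  refine h.congr fun c => ?_
  exact (image_smul_set (j i) c B).symm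

/-! ### The seminorms `q_{m,g}` against the steps `O^m_{n,ω}` -/

section Comparison

variable {N : ℕ} {ω : WeightFunction}

/-- The constant is a bound for `exp(n ω) |g|`; it serves all `f` and `α` at once. -/
lemma exists_multWeight_le (m n : ℕ+) (g : Somega N ω) : ∃ D : ℝ, 0 ≤ D ∧
    ∀ f p, weighted (multWeight N ω m g.1) f p ≤ D * weighted (stepWeight N ω m n) f p := by
  obtain ⟨-, hg, -, hd, -⟩ := g.2
  obtain ⟨D, hD⟩ := hd (n : ℝ) (by exact_mod_cast n.pos) 0
  have hD' : ∀ x, Real.exp ((n : ℝ) * ω.toFun ‖x‖) * ‖g.1 x‖ ≤ D := fun x => by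
    simpa [mderiv] using hD x
  refine ⟨D, le_trans (by positivity) (hD' 0), fun f p => ?_⟩
  have h1 : weighted (multWeight N ω m g.1) f p =
      (Real.exp ((n : ℝ) * ω.toFun ‖p.2‖) * ‖g.1 p.2‖) * weighted (stepWeight N ω m n) f p := by
    have : Real.exp ((n : ℝ) * ω.toFun ‖p.2‖) * Real.exp (-((n : ℝ) * ω.toFun ‖p.2‖)) = 1 := by
      rw [← Real.exp_add]
      simp
    simp only [weighted, multWeight, stepWeight]
    linear_combination (-(‖g.1 p.2‖ * expNeg ω m (mlen p.1) * ‖(mderiv p.1 f).1 p.2‖)) * this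
  rw [h1]
  exact mul_le_mul_of_nonneg_right (hD' p.2)
    (mul_nonneg (stepWeight_nonneg N ω m n p.1 p.2) (norm_nonneg _))

lemma unionSpace_le_weightedSpace (m : ℕ+) (g : Somega N ω) :
    unionSpace N ω m ≤ weightedSpace (multWeight N ω m g.1) (multWeight_nonneg N ω m g.1) := by
  intro f hf
  obtain ⟨n, C, hC⟩ := Set.mem_iUnion.1 hf
  obtain ⟨D, hD0, hD⟩ := exists_multWeight_le m n g
  refine ⟨D * C, ?_⟩
  rintro _ ⟨p, rfl⟩
  exact (hD f p).trans (mul_le_mul_of_nonneg_left (hC ⟨p, rfl⟩) hD0)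

/-- The extension of `q_{m,g}` to `⋃_n O^m_{n,ω}`. -/
noncomputable def unionSeminorm (N : ℕ) (ω : WeightFunction) (m : ℕ+) (g : Somega N ω) : Seminorm ℂ (unionSpace N ω m) :=
  (weightedSeminorm (multWeight N ω m g.1) (multWeight_nonneg N ω m g.1)).comp
    (Submodule.inclusion (unionSpace_le_weightedSpace m g))

/-- The topology of the extended seminorm is one of the locally convex topologies over which the
inductive topology is the infimum. -/
lemma unionTopology_le (m : ℕ+) (g : Somega N ω) :
    unionTopology N ω m ≤ seminormTopology fun _ : Unit => unionSeminorm N ω m g := by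
  have hs := withSeminorms_seminormTopology fun _ : Unit => unionSeminorm N ω m g
  refine sInf_le ⟨?_, ?_, ?_, fun n => ?_⟩
  · let _ := seminormTopology fun _ : Unit => unionSeminorm N ω m g
    exact hs.topologicalAddGroup
  · let _ := seminormTopology fun _ : Unit => unionSeminorm N ω m g
    exact hs.continuousSMul
  · let _ := seminormTopology fun _ : Unit => unionSeminorm N ω m g
    exact hs.toLocallyConvexSpace
  · let _ := seminormTopology fun _ : Unit => unionSeminorm N ω m g
    let _ := stepTopology N ω m n
    obtain ⟨D, hD0, hD⟩ := exists_multWeight_le m n g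
    refine WithSeminorms.continuous_of_isBounded
      (withSeminorms_seminormTopology fun _ : Unit => stepNorm N ω m n) hs _
      fun _ => ⟨{()}, ⟨D, hD0⟩, fun f => ?_⟩
    rw [Finset.sup_singleton]
    refine ciSup_le fun p => (hD f.1 p).trans ?_
    exact mul_le_mul_of_nonneg_left (le_ciSup f.2 p) hD0

lemma tTopology_le_tauTopology : tTopology N ω ≤ tauTopology N ω := by
  rw [tauTopology, seminormTopology_eq_iInf]
  refine le_iInf fun i => iInf_le_of_le i.1 ?_
  refine (induced_mono (unionTopology_le i.1 i.2)).trans ?_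
  have h : qSeminorm N ω i =
      (unionSeminorm N ω i.1 i.2).comp (Submodule.inclusion (OM_le N ω i.1)) := rfl
  rw [h]
  exact (seminormTopology_induced _ _).le

/-- A `τ`-bounded set is norm bounded in some step, for every `m`. -/
lemma exists_step_bound {B : Set (OM N ω)}
    (hB : @Bornology.IsVonNBounded ℂ (OM N ω) _ _ _ (tauTopology N ω) B) (m : ℕ+) :
    ∃ (n : ℕ+) (C : ℝ), ∀ f ∈ B, ∀ p, weighted (stepWeight N ω m n) f.1 p ≤ C := by
  by_contra! hcon
  -- Of `4^j = 2^j · 2^j`, one factor pays for the `2^{-j}` in `peakCoeff` and the other makes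
  -- `q_{m,g}` unbounded on `B`.
  choose f hfB p hp using fun j : ℕ => hcon j.succPNat (4 ^ j)
  set y : ℕ → Eucl N := fun j => (p j).2
  set g : Somega N ω := ⟨gaussSeries ω y, gaussSeries_mem_Somega y⟩
  obtain ⟨r, -, hr⟩ := (@WithSeminorms.isVonNBounded_iff_seminorm_bounded _ _ _ _ _ _ _
    (tauTopology N ω) B (withSeminorms_seminormTopology (qSeminorm N ω))).1 hB (m, g)
  obtain ⟨j, hj⟩ := pow_unbounded_of_one_lt r one_lt_two
  refine absurd (hr (f j) (hfB j)) (not_lt.2 (hj.le.trans ?_))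
  refine le_trans ?_ (le_ciSup (OM_le_weightedSpace N ω m g (f j).2) (p j))
  have hω := ω.nonneg _ (norm_nonneg (y j))
  have hpeak := peakCoeff_le_norm_gaussSeries (ω := ω) y j
  set d := expNeg ω m (mlen (p j).1) * ‖(mderiv (p j).1 (f j).1).1 (y j)‖
  have hd : 0 ≤ d := mul_nonneg (expNeg_nonneg _ _ _) (norm_nonneg _)
  have h1 : (4 : ℝ) ^ j < Real.exp (-(((j + 1 : ℕ) : ℝ) * ω.toFun ‖y j‖)) * d := by
    have := hp j
    simp only [weighted, stepWeight, mul_assoc] at this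
    exact this
  -- Steps are indexed from 1, hence `j + 1` against the exponent `j` of `peakCoeff`; the shift is
  -- harmless because `ω ≥ 0`.
  have h2 : Real.exp (-(((j + 1 : ℕ) : ℝ) * ω.toFun ‖y j‖)) ≤
      Real.exp (-(j * ω.toFun ‖y j‖)) := by
    refine Real.exp_le_exp.2 ?_
    push_cast
    linarith
  calc (2 : ℝ) ^ j = (1 / 2) ^ j * 4 ^ j := by rw [← mul_pow]; norm_num
    _ ≤ (1 / 2) ^ j * (Real.exp (-(j * ω.toFun ‖y j‖)) * d) := by
        gcongr
        exact h1.le.trans (mul_le_mul_of_nonneg_right h2 hd)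
    _ = peakCoeff ω y j * d := by rw [peakCoeff, mul_assoc]
    _ ≤ ‖gaussSeries ω y (y j)‖ * d := mul_le_mul_of_nonneg_right hpeak hd
    _ = _ := by simp only [weighted, multWeight, mul_assoc, g, d, y]

/-- The set lies in the image of a ball of one step under a continuous linear map, so no regularity
of the inductive limit is needed. -/
lemma isVonNBounded_unionTopology_of_step_bound {m n : ℕ+} {B : Set (unionSpace N ω m)} {C : ℝ}
    (hB : ∀ f ∈ B, ∀ p, weighted (stepWeight N ω m n) f.1 p ≤ C) :
    @Bornology.IsVonNBounded ℂ _ _ _ _ (unionTopology N ω m) B := by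
  let _ := stepTopology N ω m n
  let _ := unionTopology N ω m
  have hmem : ∀ f ∈ B, f.1 ∈ stepSpace N ω m n := by
    intro f hf
    refine ⟨C, ?_⟩
    rintro _ ⟨p, rfl⟩
    exact hB f hf p
  have hcont : Continuous (Submodule.inclusion (stepSpace_le N ω m n)) :=
    continuous_sInf_rng.2 fun T hT => hT.2.2.2 n
  have hbdd : Bornology.IsVonNBounded ℂ {f : stepSpace N ω m n | stepNorm N ω m n f ≤ C} :=
    (withSeminorms_seminormTopology
      fun _ : Unit => stepNorm N ω m n).isVonNBounded_iff_seminorm_bddAbove.2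
      fun _ => ⟨C, by rintro _ ⟨f, hf, rfl⟩; exact hf⟩
  have himage := isVonNBounded_image (stepTopology N ω m n) (unionTopology N ω m)
    (Submodule.inclusion (stepSpace_le N ω m n)) hcont hbdd
  refine Bornology.IsVonNBounded.subset (fun f hf => ?_) himage
  exact ⟨⟨f.1, hmem f hf⟩, ciSup_le fun p => hB f hf p, rfl⟩

lemma isVonNBounded_tTopology {B : Set (OM N ω)}
    (hB : ∀ m : ℕ+, @Bornology.IsVonNBounded ℂ _ _ _ _ (unionTopology N ω m)
      (Submodule.inclusion (OM_le N ω m) '' B)) :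
    @Bornology.IsVonNBounded ℂ _ _ _ _ (tTopology N ω) B := by
  have h := isVonNBounded_iInf_induced (X := OM N ω) (Y := fun m => unionSpace N ω m)
    (fun m => unionTopology N ω m) (fun m => Submodule.inclusion (OM_le N ω m)) (B := B) hB
  exact h

end Comparison

end OMomega

theorem proposition5p6 (N : ℕ) (ω : OMomega.WeightFunction) :
    Continuous[OMomega.tTopology N ω, OMomega.tauTopology N ω]
        (id : OMomega.OM N ω → OMomega.OM N ω) ∧
      ∀ B : Set (OMomega.OM N ω),
        @Bornology.IsVonNBounded ℂ (OMomega.OM N ω) _ _ _ (OMomega.tTopology N ω) B ↔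
          @Bornology.IsVonNBounded ℂ (OMomega.OM N ω) _ _ _ (OMomega.tauTopology N ω) B := by
  refine ⟨continuous_id_iff_le.2 OMomega.tTopology_le_tauTopology, fun B =>
    ⟨fun hB => hB.of_topologicalSpace_le OMomega.tTopology_le_tauTopology, fun hB => ?_⟩⟩
  refine OMomega.isVonNBounded_tTopology fun m => ?_
  obtain ⟨n, C, hC⟩ := OMomega.exists_step_bound hB m
  refine OMomega.isVonNBounded_unionTopology_of_step_bound (n := n) (C := C) ?_
  rintro _ ⟨f, hf, rfl⟩
  exact hC f hf
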